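/- Let the Euler numbers $E_m$ ($m\ge 0$) be defined by $$\frac{2}{e^t+e^{-t}}=\sum_{m=0}^\infty E_m\frac{t^m}{m!},$$ and, for a sequence $(c_0,c_1,c_2,\ldots)$ and an integer $n\ge 0$, let $$H_n(c_k)=\det_{0\le i,j\le n}\big(c_{i+j}\big)$$ be its $n$th Hankel determinant (of an $(n+1)\times(n+1)$ matrix). Then, for all integers $n\ge 0$, $$H_n\big((2k+1)E_{2k}\big)=2^{2n(n+1)}\prod_{\ell=1}^n(\ell!)^4 ,$$ where the sequence on the left is $c_k=(2k+1)E_{2k}$, $k=0,1,2,\ldots$. -/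

import Mathlib

/-- The exponential generating function `2 / (e^t + e^(-t))` of the Euler numbers, as a formal
power series. Here `rescale (-1)` substitutes `-t` for `t`; the series `e^t + e^(-t)` has constant
term `2`, so its inverse is a genuine one. -/
noncomputable def eulerSeries : PowerSeries ℚ :=
  PowerSeries.C 2 *
    (PowerSeries.exp ℚ + PowerSeries.rescale (-1 : ℚ) (PowerSeries.exp ℚ))⁻¹

/-- The defining series is the quotient it is meant to be. -/
theorem eulerSeries_mul :
    eulerSeries * (PowerSeries.exp ℚ + PowerSeries.rescale (-1 : ℚ) (PowerSeries.exp ℚ)) =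
      PowerSeries.C 2 := by
  rw [eulerSeries, mul_assoc, PowerSeries.inv_mul_cancel, mul_one]
  rw [map_add, ← PowerSeries.coeff_zero_eq_constantCoeff_apply,
    ← PowerSeries.coeff_zero_eq_constantCoeff_apply, PowerSeries.coeff_rescale,
    PowerSeries.coeff_exp]
  norm_num

/-- The Euler numbers `E_n`, given by `2 / (e^t + e^(-t)) = ∑ E_n t^n / n!`. -/
noncomputable def eulerNumber (n : ℕ) : ℚ :=
  (n.factorial : ℚ) * PowerSeries.coeff n eulerSeries

/-- The `n`th Hankel determinant `H_n(c) = det (c_{i+j})_{0 ≤ i, j ≤ n}` of a sequence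
`c_0, c_1, …`; the matrix has size `n + 1`. -/
def hankelDet {R : Type*} [CommRing R] (c : ℕ → R) (n : ℕ) : R :=
  Matrix.det (Matrix.of fun i j : Fin (n + 1) => c ((i : ℕ) + (j : ℕ)))

/-! The moments `(2k+1) E_{2k}` belong to the functional `L f = E((y f(y²))')`. Since `E` inverts
averaging over the shifts `y ± 1`, `L` is explicit on the products `∏ ((2j+1)² - X)`
(`oddEulerFunctional_oddSquareProd`). Scaled to value `1`, their alternating binomial sums are
killed by `L` in positive degree, because `(1 - 1)^n = 0`. These sums satisfy a three-term
recurrence (`dualHahn_recurrence`) with monic coefficients `b_n = 16 n⁴`. Together these two facts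
force orthogonality, so the Hankel determinant is a product of the `b_i`
(`hankelDet_eq_prod_of_threeTerm`). -/

open Polynomial in
/-- The linear functional on polynomials sending `X ^ m` to the Euler number `E_m`. -/
noncomputable def eulerFunctional : ℚ[X] →ₗ[ℚ] ℚ :=
  Polynomial.lsum fun m => eulerNumber m • LinearMap.id

open Polynomial in
theorem eulerFunctional_monomial (m : ℕ) (a : ℚ) :
    eulerFunctional (monomial m a) = eulerNumber m * a := by
  simp [eulerFunctional, Polynomial.lsum_apply]

theorem sum_choose_mul_eulerNumber (m : ℕ) :
    ∑ k ∈ Finset.range (m + 1), (m.choose k : ℚ) * eulerNumber k * (1 + (-1) ^ (m - k)) =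
      if m = 0 then 2 else 0 := by
  have h := congrArg (fun s => (m.factorial : ℚ) * PowerSeries.coeff m s) eulerSeries_mul
  simp only [PowerSeries.coeff_mul, PowerSeries.coeff_C, map_add, PowerSeries.coeff_rescale,
    PowerSeries.coeff_exp] at h
  rw [Finset.Nat.sum_antidiagonal_eq_sum_range_succ_mk, Finset.mul_sum] at h
  have h2 : (m.factorial : ℚ) * (if m = 0 then 2 else 0) = if m = 0 then 2 else 0 := by
    split_ifs with h0
    · simp [h0]
    · simp
  rw [← h2, ← h]
  refine Finset.sum_congr rfl fun k hk => ?_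
  have hkm : k ≤ m := Nat.lt_succ_iff.mp (Finset.mem_range.mp hk)
  have h3 : (m.factorial : ℚ) = m.choose k * k.factorial * (m - k).factorial := by
    exact_mod_cast (Nat.choose_mul_factorial_mul_factorial hkm).symm
  have h4 : ((m - k).factorial : ℚ) ≠ 0 := by positivity
  rw [h3, eulerNumber]
  simp only [eq_ratCast, Rat.cast_eq_id, id]
  field_simp

open Polynomial in
/-- The Euler functional inverts the averaging operator: `E(f(y+1) + f(y-1)) = 2 f(0)`. -/
theorem eulerFunctional_shift (f : ℚ[X]) :
    eulerFunctional (f.comp (X + 1) + f.comp (X - 1)) = 2 * f.eval 0 := by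
  induction f using Polynomial.induction_on' with
  | add p q hp hq =>
    rw [add_comp, add_comp, eval_add, mul_add, ← hp, ← hq, ← map_add]
    congr 1; ring
  | monomial m a =>
    have e : (monomial m a).comp (X + 1) + (monomial m a).comp (X - 1) =
        ∑ k ∈ Finset.range (m + 1),
          monomial k (a * (m.choose k : ℚ) * (1 + (-1) ^ (m - k))) := by
      rw [monomial_comp, monomial_comp, sub_eq_add_neg X, add_pow, add_pow, Finset.mul_sum,
        Finset.mul_sum, ← Finset.sum_add_distrib]
      refine Finset.sum_congr rfl fun k _ => ?_
      rw [← C_mul_X_pow_eq_monomial]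
      simp only [map_mul, map_add, map_pow, map_neg, map_one, map_natCast]
      ring
    rw [e, map_sum]
    simp only [eulerFunctional_monomial]
    have h := sum_choose_mul_eulerNumber m
    have : ∑ k ∈ Finset.range (m + 1),
        eulerNumber k * (a * (m.choose k : ℚ) * (1 + (-1) ^ (m - k))) =
        a * ∑ k ∈ Finset.range (m + 1),
          (m.choose k : ℚ) * eulerNumber k * (1 + (-1) ^ (m - k)) := by
      rw [Finset.mul_sum]
      exact Finset.sum_congr rfl fun k _ => by ring
    rw [this, h]
    split_ifs with h0
    · subst h0; simp [mul_comm]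
    · simp [h0]

/-! ### The moment functional on products of odd squares -/

open Polynomial in
/-- The functional with moments `(2k+1) E_{2k}`, namely `f ↦ E((y f(y²))')`. -/
noncomputable def oddEulerFunctional : ℚ[X] →ₗ[ℚ] ℚ :=
  eulerFunctional ∘ₗ Polynomial.derivative ∘ₗ LinearMap.mulLeft ℚ (X : ℚ[X]) ∘ₗ
    (Polynomial.aeval (X ^ 2 : ℚ[X])).toLinearMap

open Polynomial in
theorem oddEulerFunctional_apply (f : ℚ[X]) :
    oddEulerFunctional f = eulerFunctional (derivative (X * f.comp (X ^ 2))) := by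
  rw [comp, ← algebraMap_eq, ← aeval_def]
  rfl

open Polynomial in
theorem oddEulerFunctional_X_pow (k : ℕ) :
    oddEulerFunctional (X ^ k) = (2 * (k : ℚ) + 1) * eulerNumber (2 * k) := by
  have h : X * (X ^ k : ℚ[X]).comp (X ^ 2) = monomial (2 * k + 1) 1 := by
    rw [X_pow_comp, ← pow_mul, ← pow_succ', X_pow_eq_monomial]
  rw [oddEulerFunctional_apply, h, derivative_monomial, eulerFunctional_monomial]
  push_cast
  simp [mul_comm]

open Polynomial in
/-- The product `∏_{j<k} ((2j+1)² - X)`. -/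
noncomputable def oddSquareProd (k : ℕ) : ℚ[X] :=
  ∏ j ∈ Finset.range k, (C ((2 * (j : ℚ) + 1) ^ 2) - X)

open Polynomial in
/-- The product `X ∏_{1≤j≤k} ((2j)² - X²)`. -/
noncomputable def evenSquareProd (k : ℕ) : ℚ[X] :=
  X * ∏ j ∈ Finset.range k, (C ((2 * (j : ℚ) + 2) ^ 2) - X ^ 2)

-- The shift carries the zeros `0, ±2, …, ±2k` to `±1, …, ±(2k-1)` and an unpaired `-(2k+1)`.
open Polynomial in
theorem evenSquareProd_comp_add_one (k : ℕ) :
    (evenSquareProd k).comp (X + 1) =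
      (X + C (2 * (k : ℚ) + 1)) * (oddSquareProd k).comp (X ^ 2) := by
  induction k with
  | zero => simp [evenSquareProd, oddSquareProd]
  | succ k ih =>
    have h1 : evenSquareProd (k + 1) =
        evenSquareProd k * (C ((2 * (k : ℚ) + 2) ^ 2) - X ^ 2) := by
      simp only [evenSquareProd, Finset.prod_range_succ, mul_assoc]
    rw [h1, mul_comp, ih, oddSquareProd, oddSquareProd, Finset.prod_range_succ, mul_comp]
    simp only [sub_comp, C_comp, X_comp, pow_comp]
    simp only [map_add, map_mul, map_pow, map_one, map_ofNat, map_natCast]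
    push_cast
    ring

open Polynomial in
theorem evenSquareProd_comp_sub_one (k : ℕ) :
    (evenSquareProd k).comp (X - 1) =
      (X - C (2 * (k : ℚ) + 1)) * (oddSquareProd k).comp (X ^ 2) := by
  induction k with
  | zero => simp [evenSquareProd, oddSquareProd]
  | succ k ih =>
    have h1 : evenSquareProd (k + 1) =
        evenSquareProd k * (C ((2 * (k : ℚ) + 2) ^ 2) - X ^ 2) := by
      simp only [evenSquareProd, Finset.prod_range_succ, mul_assoc]
    rw [h1, mul_comp, ih, oddSquareProd, oddSquareProd, Finset.prod_range_succ, mul_comp]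
    simp only [sub_comp, C_comp, X_comp, pow_comp]
    simp only [map_add, map_mul, map_pow, map_one, map_ofNat, map_natCast]
    push_cast
    ring

-- Adding the two shifts cancels the constants `±(2k+1)`. Differentiation commutes with shifts, so
-- only the derivative of `evenSquareProd k` at `0` survives.
open Polynomial in
theorem oddEulerFunctional_oddSquareProd (k : ℕ) :
    oddEulerFunctional (oddSquareProd k) = 4 ^ k * (k.factorial : ℚ) ^ 2 := by
  have key : (evenSquareProd k).comp (X + 1) + (evenSquareProd k).comp (X - 1) =
      (2 : ℚ) • (X * (oddSquareProd k).comp (X ^ 2)) := by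
    rw [evenSquareProd_comp_add_one, evenSquareProd_comp_sub_one, smul_eq_C_mul, map_ofNat]
    ring
  have hd := congrArg derivative key
  have hX1 : derivative (X + 1 : ℚ[X]) = 1 := by simp
  have hX2 : derivative (X - 1 : ℚ[X]) = 1 := by simp
  rw [derivative_add, derivative_comp, derivative_comp, hX1, hX2, one_mul, one_mul,
    derivative_smul] at hd
  have hs := eulerFunctional_shift (derivative (evenSquareProd k))
  rw [hd, map_smul, smul_eq_mul, ← oddEulerFunctional_apply] at hs
  rw [mul_left_cancel₀ two_ne_zero hs, evenSquareProd, derivative_mul]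
  simp only [derivative_X, one_mul, eval_add, eval_mul, eval_X, zero_mul, add_zero, eval_prod,
    eval_sub, eval_C, eval_pow]
  clear hs hd key
  induction k with
  | zero => simp
  | succ k ih =>
    rw [Finset.prod_range_succ, ih, Nat.factorial_succ]
    push_cast
    ring

open Polynomial in
/-- Normalisation of `oddSquareProd k` on which `oddEulerFunctional` takes the value `1`. -/
noncomputable def normOddSquareProd (k : ℕ) : ℚ[X] :=
  ((4 ^ k * (k.factorial : ℚ) ^ 2)⁻¹ : ℚ) • oddSquareProd k

open Polynomial in
theorem oddEulerFunctional_normOddSquareProd (k : ℕ) :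
    oddEulerFunctional (normOddSquareProd k) = 1 := by
  rw [normOddSquareProd, map_smul, oddEulerFunctional_oddSquareProd, smul_eq_mul]
  exact inv_mul_cancel₀ (by positivity)

open Polynomial in
theorem X_mul_normOddSquareProd (k : ℕ) :
    X * normOddSquareProd k = C ((2 * (k : ℚ) + 1) ^ 2) * normOddSquareProd k -
      C (4 * ((k : ℚ) + 1) ^ 2) * normOddSquareProd (k + 1) := by
  have h : C (4 * ((k : ℚ) + 1) ^ 2) * normOddSquareProd (k + 1) =
      (C ((2 * (k : ℚ) + 1) ^ 2) - X) * normOddSquareProd k := by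
    rw [normOddSquareProd, normOddSquareProd, oddSquareProd, Finset.prod_range_succ,
      ← oddSquareProd, smul_eq_C_mul, smul_eq_C_mul, ← mul_assoc, ← C_mul]
    have : 4 * ((k : ℚ) + 1) ^ 2 * (4 ^ (k + 1) * ((k + 1).factorial : ℚ) ^ 2)⁻¹ =
        (4 ^ k * (k.factorial : ℚ) ^ 2)⁻¹ := by
      have : (k.factorial : ℚ) ≠ 0 := by positivity
      rw [Nat.factorial_succ]
      push_cast
      field_simp
      ring
    rw [this]
    ring
  rw [h]
  ring

/-! ### Dual Hahn polynomials -/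

open Polynomial in
/-- The continuous dual Hahn polynomials with all parameters `1/2`, in the variable `-4x²`. -/
noncomputable def dualHahn (n : ℕ) : ℚ[X] :=
  ∑ k ∈ Finset.range (n + 1), C ((-1) ^ k * (n.choose k : ℚ)) * normOddSquareProd k

open Polynomial in
theorem dualHahn_eq_sum_range {n N : ℕ} (h : n + 1 ≤ N) :
    dualHahn n = ∑ k ∈ Finset.range N, C ((-1) ^ k * (n.choose k : ℚ)) * normOddSquareProd k := by
  refine Finset.sum_subset (Finset.range_mono h) fun k _ hk => ?_
  rw [Nat.choose_eq_zero_of_lt (by simpa using hk)]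
  simp

theorem oddEulerFunctional_dualHahn_succ (n : ℕ) :
    oddEulerFunctional (dualHahn (n + 1)) = 0 := by
  rw [dualHahn, map_sum]
  simp only [← Polynomial.smul_eq_C_mul, map_smul, oddEulerFunctional_normOddSquareProd,
    smul_eq_mul, mul_one]
  exact_mod_cast Int.alternating_sum_range_choose_of_ne n.succ_ne_zero

/-- This compares coefficients of `normOddSquareProd k` in the recurrence, with the sign `(-1)^k`
removed. The factor `k²` makes the truncated `k - 1` harmless at `k = 0`. -/
theorem dualHahn_coeff_identity (m k : ℕ) :
    4 * ((m : ℚ) + 2) ^ 2 * ((m + 2).choose k : ℚ) =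
      ((2 * (k : ℚ) + 1) ^ 2 + (4 * ((m : ℚ) + 2) ^ 2 + 4 * ((m : ℚ) + 1) ^ 2 - 1)) *
          ((m + 1).choose k : ℚ) +
        4 * (k : ℚ) ^ 2 * ((m + 1).choose (k - 1) : ℚ) -
        4 * ((m : ℚ) + 1) ^ 2 * (m.choose k : ℚ) := by
  cases k with
  | zero => simp
  | succ j =>
    have hb : ((j : ℚ) + 1) * (m.choose (j + 1) : ℚ) = ((m : ℚ) - j) * (m.choose j : ℚ) := by
      have h1 : ((m + 1 : ℕ) : ℚ) * (m.choose j : ℚ) =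
          ((m + 1).choose (j + 1) : ℚ) * ((j + 1 : ℕ) : ℚ) := by
        exact_mod_cast Nat.add_one_mul_choose_eq m j
      rw [Nat.choose_succ_succ] at h1
      push_cast at h1
      linear_combination -h1
    have hc : ((m : ℚ) + 1 - j) * ((m + 1).choose j : ℚ) = ((m : ℚ) + 1) * (m.choose j : ℚ) := by
      have h1 : ((m + 2 : ℕ) : ℚ) * ((m + 1).choose j : ℚ) =
          ((m + 2).choose (j + 1) : ℚ) * ((j + 1 : ℕ) : ℚ) := by
        exact_mod_cast Nat.add_one_mul_choose_eq (m + 1) j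
      rw [Nat.choose_succ_succ (m + 1), Nat.choose_succ_succ m] at h1
      push_cast at h1
      linear_combination h1 + hb
    rw [Nat.choose_succ_succ (m + 1), Nat.choose_succ_succ m, Nat.add_sub_cancel]
    push_cast
    linear_combination 4 * ((m : ℚ) + 3 + j) * hc - 4 * ((j : ℚ) + 2) * hb

open Polynomial in
theorem dualHahn_recurrence (m : ℕ) :
    C (4 * ((m : ℚ) + 2) ^ 2) * dualHahn (m + 2) =
      (X + C (4 * ((m : ℚ) + 2) ^ 2 + 4 * ((m : ℚ) + 1) ^ 2 - 1)) * dualHahn (m + 1) -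
        C (4 * ((m : ℚ) + 1) ^ 2) * dualHahn m := by
  -- Truncating at `N` leaves one boundary term, because multiplication by `X` spills into the next
  -- basis element; it vanishes at `N = m + 3`.
  have partialSum (N : ℕ) :
      C (4 * ((m : ℚ) + 2) ^ 2) * (∑ k ∈ Finset.range N,
          C ((-1) ^ k * ((m + 2).choose k : ℚ)) * normOddSquareProd k) =
      (X + C (4 * ((m : ℚ) + 2) ^ 2 + 4 * ((m : ℚ) + 1) ^ 2 - 1)) * (∑ k ∈ Finset.range N,
          C ((-1) ^ k * ((m + 1).choose k : ℚ)) * normOddSquareProd k) -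
        C (4 * ((m : ℚ) + 1) ^ 2) * (∑ k ∈ Finset.range N,
          C ((-1) ^ k * (m.choose k : ℚ)) * normOddSquareProd k) -
        C ((-1) ^ N * (4 * (N : ℚ) ^ 2 * ((m + 1).choose (N - 1) : ℚ))) *
          normOddSquareProd N := by
    induction N with
    | zero => simp
    | succ N ih =>
      simp only [Finset.sum_range_succ, mul_add, ih]
      have hX := X_mul_normOddSquareProd N
      have hI := congrArg (C : ℚ → ℚ[X]) (dualHahn_coeff_identity m N)
      simp only [Nat.add_sub_cancel, Nat.cast_add, Nat.cast_one, C_mul, C_add, C_sub, C_pow,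
        C_neg, C_1] at hI hX ⊢
      linear_combination (-1) ^ N * normOddSquareProd N * hI -
        (-1) ^ N * C ((m + 1).choose N : ℚ) * hX
  have h := partialSum (m + 3)
  rw [← dualHahn_eq_sum_range (by omega), ← dualHahn_eq_sum_range (by omega),
    ← dualHahn_eq_sum_range (by omega), Nat.choose_eq_zero_of_lt (by omega)] at h
  simpa using h

/-! ### Orthogonality and Hankel determinants -/

open Polynomial in
/-- The monic polynomials given by a three-term recurrence. -/
noncomputable def threeTerm {R : Type*} [CommRing R] (a b : ℕ → R) : ℕ → R[X]
  | 0 => 1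
  | 1 => X - C (a 0)
  | n + 2 => (X - C (a (n + 1))) * threeTerm a b (n + 1) - C (b (n + 1)) * threeTerm a b n

open Polynomial in
theorem threeTerm_monic_natDegree {R : Type*} [CommRing R] [Nontrivial R] (a b : ℕ → R) (n : ℕ) :
    (threeTerm a b n).Monic ∧ (threeTerm a b n).natDegree = n := by
  induction n using Nat.twoStepInduction with
  | zero => simp [threeTerm]
  | one => exact ⟨monic_X_sub_C _, natDegree_X_sub_C _⟩
  | more n h0 h1 =>
    have hm : ((X - C (a (n + 1))) * threeTerm a b (n + 1)).Monic :=
      (monic_X_sub_C _).mul h1.1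
    have hd : ((X - C (a (n + 1))) * threeTerm a b (n + 1)).natDegree = n + 2 := by
      rw [(monic_X_sub_C _).natDegree_mul h1.1, natDegree_X_sub_C, h1.2]
      ring
    have hlt : (C (b (n + 1)) * threeTerm a b n).natDegree < n + 2 :=
      (natDegree_C_mul_le _ _).trans_lt (by omega)
    have hlt' : (C (b (n + 1)) * threeTerm a b n).degree <
        ((X - C (a (n + 1))) * threeTerm a b (n + 1)).degree :=
      degree_lt_degree (by rwa [hd])
    exact ⟨hm.sub_of_left hlt', by
      rw [threeTerm, natDegree_sub_eq_left_of_natDegree_lt (by rwa [hd]), hd]⟩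

open Polynomial in
/-- If `L` kills every `P_n` with `n ≥ 1`, then `P_n` is orthogonal to lower powers of `X`. -/
theorem functional_X_pow_mul_threeTerm {R : Type*} [CommRing R] (a b : ℕ → R) (L : R[X] →ₗ[R] R)
    (h0 : L 1 = 1) (h : ∀ n, L (threeTerm a b (n + 1)) = 0) (m : ℕ) :
    (∀ n, m < n → L (X ^ m * threeTerm a b n) = 0) ∧
      L (X ^ m * threeTerm a b m) = ∏ i ∈ Finset.range m, b (i + 1) := by
  induction m with
  | zero =>
    refine ⟨fun n hn => ?_, by simpa [threeTerm] using h0⟩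
    obtain ⟨k, rfl⟩ := Nat.exists_eq_succ_of_ne_zero hn.ne'
    simpa using h k
  | succ m ih =>
    -- The recurrence solved for `X * P_{n+1}` trades a power of `X` for neighbouring indices.
    have step (n : ℕ) : L (X ^ (m + 1) * threeTerm a b (n + 1)) =
        L (X ^ m * threeTerm a b (n + 2)) + a (n + 1) * L (X ^ m * threeTerm a b (n + 1)) +
          b (n + 1) * L (X ^ m * threeTerm a b n) := by
      rw [← smul_eq_mul (a (n + 1)), ← smul_eq_mul (b (n + 1)), ← map_smul, ← map_smul,
        ← map_add, ← map_add, threeTerm, smul_eq_C_mul, smul_eq_C_mul]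
      congr 1
      ring
    constructor
    · intro n hn
      obtain ⟨k, rfl⟩ := Nat.exists_eq_succ_of_ne_zero (Nat.ne_zero_of_lt hn)
      rw [Nat.succ_eq_add_one, step, ih.1 _ (by omega), ih.1 _ (by omega), ih.1 _ (by omega)]
      simp
    · rw [step, ih.1 _ (by omega), ih.1 _ (by omega), ih.2, Finset.prod_range_succ]
      ring

open Polynomial in
/-- The Hankel determinant of the moments of a functional with orthogonal polynomials given by a
three-term recurrence. -/
theorem hankelDet_eq_prod_of_threeTerm {R : Type*} [CommRing R] [Nontrivial R] (a b : ℕ → R)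
    (L : R[X] →ₗ[R] R) (h0 : L 1 = 1) (h : ∀ n, L (threeTerm a b (n + 1)) = 0) (n : ℕ) :
    hankelDet (fun k => L (X ^ k)) n =
      ∏ m ∈ Finset.range (n + 1), ∏ i ∈ Finset.range m, b (i + 1) := by
  set A : Matrix (Fin (n + 1)) (Fin (n + 1)) R :=
    Matrix.of fun i j => (threeTerm a b (j : ℕ)).coeff (i : ℕ) with hA
  have hdetA : A.det = 1 :=
    Matrix.det_matrixOfPolynomials (fun j : Fin (n + 1) => threeTerm a b (j : ℕ))
      (fun j => (threeTerm_monic_natDegree a b j).2) (fun j => (threeTerm_monic_natDegree a b j).1)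
  set M : Matrix (Fin (n + 1)) (Fin (n + 1)) R :=
    Matrix.of fun i j => L (X ^ ((i : ℕ) + (j : ℕ))) with hM
  -- `A` has determinant `1`, and orthogonality makes `M * A` lower triangular.
  have hentry (i j : Fin (n + 1)) : (M * A) i j = L (X ^ (i : ℕ) * threeTerm a b (j : ℕ)) := by
    have hd : (threeTerm a b (j : ℕ)).natDegree < n + 1 := by
      rw [(threeTerm_monic_natDegree a b j).2]; exact j.2
    conv_rhs => rw [(threeTerm a b (j : ℕ)).as_sum_range' (n + 1) hd]
    rw [Finset.mul_sum, map_sum, Matrix.mul_apply, ← Fin.sum_univ_eq_sum_range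
      (fun k => L (X ^ (i : ℕ) * monomial k ((threeTerm a b (j : ℕ)).coeff k)))]
    refine Finset.sum_congr rfl fun k _ => ?_
    simp only [hM, hA, Matrix.of_apply]
    rw [mul_comm, ← smul_eq_mul, ← map_smul, ← C_mul_X_pow_eq_monomial, smul_eq_C_mul, pow_add]
    congr 1
    ring
  have hdet : (M * A).det = ∏ m ∈ Finset.range (n + 1), ∏ i ∈ Finset.range m, b (i + 1) := by
    rw [Matrix.det_of_isLowerTriangular, ← Fin.prod_univ_eq_prod_range
      (fun m => ∏ i ∈ Finset.range m, b (i + 1))]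
    · exact Finset.prod_congr rfl fun i _ => by
        rw [hentry, (functional_X_pow_mul_threeTerm a b L h0 h i).2]
    · intro i j hij
      rw [hentry]
      exact (functional_X_pow_mul_threeTerm a b L h0 h i).1 _ (by simpa using hij)
  rw [← hdet, Matrix.det_mul, hdetA, mul_one]
  rfl

-- The factor `4^n n!²` makes `dualHahn n` monic.
open Polynomial in
theorem threeTerm_eq_dualHahn (n : ℕ) :
    threeTerm (fun n : ℕ => 1 - 4 * ((n : ℚ) + 1) ^ 2 - 4 * (n : ℚ) ^ 2)
        (fun n : ℕ => 16 * (n : ℚ) ^ 4) n =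
      C (4 ^ n * (n.factorial : ℚ) ^ 2) * dualHahn n := by
  induction n using Nat.twoStepInduction with
  | zero => simp [threeTerm, dualHahn, normOddSquareProd, oddSquareProd]
  | one =>
    have h := X_mul_normOddSquareProd 0
    have h0 : normOddSquareProd 0 = 1 := by simp [normOddSquareProd, oddSquareProd]
    simp only [threeTerm, dualHahn, Finset.sum_range_succ, h0] at h ⊢
    norm_num at h ⊢
    simp only [map_ofNat] at h ⊢
    linear_combination h
  | more n ih0 ih1 =>
    rw [threeTerm, ih0, ih1]
    have h := dualHahn_recurrence n
    simp only [Nat.factorial_succ, Nat.cast_mul, Nat.cast_add, Nat.cast_one, C_mul, C_add, C_sub,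
      C_pow, C_1, map_ofNat, map_natCast] at h ⊢
    linear_combination (-4 ^ (n + 1) * ((n : ℚ[X]) + 1) ^ 2 * (n.factorial : ℚ[X]) ^ 2) * h

theorem corollary5p2 (n : ℕ) :
    hankelDet (fun k : ℕ => (2 * (k : ℚ) + 1) * eulerNumber (2 * k)) n =
      2 ^ (2 * n * (n + 1)) * ∏ l ∈ Finset.Icc 1 n, ((l.factorial : ℚ)) ^ 4 := by
  simp only [← oddEulerFunctional_X_pow]
  have h1 : oddEulerFunctional 1 = 1 := by
    simpa [oddSquareProd] using oddEulerFunctional_oddSquareProd 0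
  rw [hankelDet_eq_prod_of_threeTerm _ _ oddEulerFunctional h1 fun m => by
    rw [threeTerm_eq_dualHahn, ← Polynomial.smul_eq_C_mul, map_smul,
      oddEulerFunctional_dualHahn_succ, smul_zero]]
  have hprod (m : ℕ) : ∏ i ∈ Finset.range m, 16 * (((i + 1 : ℕ) : ℚ)) ^ 4 =
      16 ^ m * (m.factorial : ℚ) ^ 4 := by
    rw [Finset.prod_mul_distrib, Finset.prod_const, Finset.card_range, Finset.prod_pow,
      ← Finset.prod_range_add_one_eq_factorial]
    push_cast
    rfl
  simp only [hprod]
  induction n with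
  | zero => simp
  | succ n ih =>
    rw [Finset.prod_range_succ, ih, Finset.prod_Icc_succ_top (by omega),
      show (16 : ℚ) = 2 ^ 4 by norm_num, ← pow_mul,
      show 2 * (n + 1) * (n + 1 + 1) = 2 * n * (n + 1) + 4 * (n + 1) by ring, pow_add]
    ring
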